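/- Let $\Gamma=\langle R_0,R_1,R_2\mid R_0^2=R_1^2=R_2^2=(R_0R_2)^2=1\rangle$. A (connected) map $\mathcal M$ is given by a non-empty set $\Phi$ of flags and permutations $r_0,r_1,r_2$ of $\Phi$ with $r_i^2=(r_0r_2)^2=1$ that generate a transitive group $G$; equivalently, by the transitive action of $\Gamma$ on $\Phi$ with $R_i\mapsto r_i$, whose point stabilisers are the map subgroups $M\le\Gamma$ of $\mathcal M$. (Vertices, edges and faces are the orbits of $\langle r_1,r_2\rangle$, $\langle r_0,r_2\rangle$ and $\langle r_0,r_1\rangle$.) The map is finite if $\Phi$ is finite, and $\operatorname{Aut}\mathcal M$ is the centraliser of $G$ in $\operatorname{Sym}\Phi$. A reflection of type $i$ of $\mathcal M$ ($i=0,1,2$) is a non-identity automorphism that sends some flag $\phi$ to $\phi r_i$ (a reflection may have more than one type). Let $cr_i(\mathcal M)$ be the number of conjugacy classes in $\operatorname{Aut}\mathcal M$ of reflections of type $i$, and $cr(\mathcal M)$ the number of conjugacy classes in $\operatorname{Aut}\mathcal M$ of reflections of any type. Given any integers $c_0,c_1,c_2\ge 0$, with $c_0,c_2\ge 1$ if $c_1$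 is odd, there is a finite map $\mathcal M$ with $cr_i(\mathcal M)=c_i$ for $i=0,1,2$ and $cr(\mathcal M)=c_0+c_1+c_2$. Moreover, $\mathcal M$ can be chosen to have a map subgroup of the form $M=N'N^2$, the subgroup generated by all commutators and squares of elements of $N$, where $N$ is a subgroup of finite index in $\Gamma$ with $N_\Gamma(M)=N$. -/

import Mathlib

/-- The relators `R₀²`, `R₁²`, `R₂²`, `(R₀R₂)²`. -/
def mapRels : Set (FreeGroup (Fin 3)) :=
  {w | (∃ i : Fin 3, w = FreeGroup.of i ^ 2) ∨ w = (FreeGroup.of 0 * FreeGroup.of 2) ^ 2}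

/-- The group `Γ = ⟨R₀, R₁, R₂ ∣ R₀² = R₁² = R₂² = (R₀R₂)² = 1⟩`. -/
abbrev MapGroup : Type := PresentedGroup mapRels

/-- A (connected) map, given by its set of flags and the three permutations `r 0`, `r 1`, `r 2` of
the flags: `r i` sends a flag to the other flag with the same `j`-dimensional components for all
`j ≠ i`, or fixes it if there is no such flag (boundary flag). Vertices, edges and faces are the
orbits of `⟨r 1, r 2⟩`, `⟨r 0, r 2⟩` and `⟨r 0, r 1⟩`, incidence being non-empty intersection. -/
structure FlagMap where
  Flag : Type
  r : Fin 3 → Equiv.Perm Flag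
  r_sq : ∀ i, r i ^ 2 = 1
  r_zero_two_sq : (r 0 * r 2) ^ 2 = 1
  flag_nonempty : Nonempty Flag
  connected : ∀ φ ψ : Flag, ∃ g ∈ Subgroup.closure (Set.range r), g φ = ψ

namespace FlagMap

theorem lift_rels (𝓜 : FlagMap) : ∀ w ∈ mapRels, FreeGroup.lift 𝓜.r w = 1 := by
  rintro w (⟨i, rfl⟩ | rfl)
  · simpa using 𝓜.r_sq i
  · simpa using 𝓜.r_zero_two_sq

/-- The permutation representation `R_i ↦ r_i` of `Γ` on the flags. -/
def rep (𝓜 : FlagMap) : MapGroup →* Equiv.Perm 𝓜.Flag :=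
  PresentedGroup.toGroup 𝓜.lift_rels

/-- The map subgroup belonging to the flag `φ`: its stabiliser in `Γ`. (It is the same subgroup
whether `Γ` acts on the left, as here, or on the right, since the generators are involutions and
reversing a word is therefore inverting it.) -/
def mapSubgroup (𝓜 : FlagMap) (φ : 𝓜.Flag) : Subgroup MapGroup :=
  (MulAction.stabilizer (Equiv.Perm 𝓜.Flag) φ).comap 𝓜.rep

/-- The monodromy group `⟨r₀, r₁, r₂⟩`. -/
def Mon (𝓜 : FlagMap) : Subgroup (Equiv.Perm 𝓜.Flag) :=
  Subgroup.closure (Set.range 𝓜.r)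

/-- The automorphism group: the centraliser of the monodromy group in the symmetric group. -/
def Aut (𝓜 : FlagMap) : Subgroup (Equiv.Perm 𝓜.Flag) :=
  Subgroup.centralizer (𝓜.Mon : Set (Equiv.Perm 𝓜.Flag))

/-- `a` is a reflection having an action of type `i` on some flag: it is a non-identity
automorphism sending some flag `φ` to `r i φ`, i.e. it reflects the surface in the side that the
flags `φ` and `r i φ` have in common. A reflection may have several types. -/
def IsReflectionOfType (𝓜 : FlagMap) (i : Fin 3) (a : 𝓜.Aut) : Prop :=
  a ≠ 1 ∧ ∃ φ : 𝓜.Flag, (a : Equiv.Perm 𝓜.Flag) φ = 𝓜.r i φ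

/-- `a` is a reflection of the map. -/
def IsReflection (𝓜 : FlagMap) (a : 𝓜.Aut) : Prop :=
  ∃ i : Fin 3, 𝓜.IsReflectionOfType i a

/-- `cr_i(𝓜)`: the number of conjugacy classes in `Aut 𝓜` of reflections of type `i`. -/
noncomputable def crType (𝓜 : FlagMap) (i : Fin 3) : ℕ∞ :=
  (ConjClasses.mk '' {a : 𝓜.Aut | 𝓜.IsReflectionOfType i a}).encard

/-- `cr(𝓜)`: the number of conjugacy classes of reflections in `Aut 𝓜`. -/
noncomputable def cr (𝓜 : FlagMap) : ℕ∞ :=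
  (ConjClasses.mk '' {a : 𝓜.Aut | 𝓜.IsReflection a}).encard

end FlagMap

/-- `N'N²`: the subgroup generated by the commutators and the squares of the elements of `N`. -/
def commSquares {G : Type*} [Group G] (N : Subgroup G) : Subgroup G :=
  Subgroup.closure ({g | ∃ x ∈ N, ∃ y ∈ N, g = x * y * x⁻¹ * y⁻¹} ∪ {g | ∃ x ∈ N, g = x ^ 2})

/-! Let `N` be the stabiliser of a flag `φ` of a finite base map `𝓑`, and let `M = N'N²`. Then `N/M`
is a finite elementary abelian 2-group. If `N` is the whole normaliser of `M`, it is the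
automorphism group of the map with map subgroup `M`, and conjugacy classes are single elements. An
automorphism `n` sends `gM` to `R_i gM` exactly when `n ≡ g⁻¹ R_i g` mod `M`, which forces `r_i` to
fix `gφ`. So reflections of type `i` come from boundary sides of `𝓑` of type `i`. This
correspondence is bijective. Conjugates of `R_i` at one side differ by a commutator in `N`
(`conj_R_congr`). Different sides are separated by a voltage: giving `R_i` the basis vector of the
side at each boundary flag defines a homomorphism from `N` to a vector space over the field of two
elements, and it kills `M` (`volt_eq_zero_of_mem_commSquares`). Hence `cr_i` counts the boundary
sides of type `i`, and no reflection has two types. It remains to find `𝓑` with prescribed numbers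
of boundary sides and with normaliser `N`. Rigidity of `φ` gives the latter
(`IsRigid.normalizer_eq`). In the strip maps, `r₁r₀r₂` rotates a cycle of `n > 4` flags and has
order at most 2 on the remaining flags, so squares distinguish the two kinds of flags. The aperiodic
positions of the exits from the cycle then single out the flag `0`. For odd `n` the reflection `x ↦
1 - x` has one fixed flag, and `0` lies on boundary sides of types 0 and 2. For even `n` none of
these three sides occurs. This is where the parity condition on `c₁` enters. -/

section CommSquares

/-! ### The subgroup `N'N²`. -/

variable {G : Type*} [Group G]

theorem sq_mem_commSquares {N : Subgroup G} {x : G} (hx : x ∈ N) : x ^ 2 ∈ commSquares N :=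
  Subgroup.subset_closure (Or.inr ⟨x, hx, rfl⟩)

theorem commutator_mem_commSquares {N : Subgroup G} {x y : G} (hx : x ∈ N) (hy : y ∈ N) :
    x * y * x⁻¹ * y⁻¹ ∈ commSquares N :=
  Subgroup.subset_closure (Or.inl ⟨x, hx, y, hy, rfl⟩)

theorem commSquares_le (N : Subgroup G) : commSquares N ≤ N := by
  refine (Subgroup.closure_le _).2 ?_
  rintro g (⟨x, hx, y, hy, rfl⟩ | ⟨x, hx, rfl⟩)
  · exact N.mul_mem (N.mul_mem (N.mul_mem hx hy) (N.inv_mem hx)) (N.inv_mem hy)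
  · exact N.pow_mem hx 2

theorem conj_mem_commSquares {N : Subgroup G} {n m : G} (hn : n ∈ N) (hm : m ∈ commSquares N) :
    n * m * n⁻¹ ∈ commSquares N := by
  have := (commSquares N).mul_mem (commutator_mem_commSquares hn (commSquares_le N hm)) hm
  simpa [mul_assoc] using this

theorem le_normalizer_commSquares (N : Subgroup G) :
    N ≤ Subgroup.normalizer (commSquares N : Set G) := by
  intro n hn
  refine Subgroup.mem_normalizer_iff.2 fun m => ⟨conj_mem_commSquares hn, fun hm => ?_⟩
  have := conj_mem_commSquares (N.inv_mem hn) hm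
  simpa [mul_assoc] using this

/-- A finitely generated group has finite index `N'N²` for each subgroup `N` of finite index. -/
theorem finiteIndex_commSquares [Group.FG G] (N : Subgroup G) [N.FiniteIndex] :
    (commSquares N).FiniteIndex := by
  -- By Schreier's lemma `N` is finitely generated, so its quotient of exponent 2 is a finitely
  -- generated torsion abelian group, hence finite.
  have : Group.FG N := Subgroup.fg_of_index_ne_zero N
  let M : Subgroup N := (commSquares N).subgroupOf N
  have hM : M.Normal := by
    refine ⟨fun m hm n => ?_⟩
    rw [Subgroup.mem_subgroupOf] at hm ⊢
    exact conj_mem_commSquares n.2 hm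
  let _ : CommGroup (N ⧸ M) :=
    { (inferInstance : Group (N ⧸ M)) with
      mul_comm := by
        rintro ⟨x⟩ ⟨y⟩
        refine QuotientGroup.eq.2 (Subgroup.mem_subgroupOf.2 ?_)
        have := commutator_mem_commSquares (N.inv_mem y.2) (N.inv_mem x.2)
        simpa [mul_assoc] using this }
  have tors : IsMulTorsion (N ⧸ M) := by
    rintro ⟨x⟩
    refine isOfFinOrder_iff_pow_eq_one.2 ⟨2, by norm_num, ?_⟩
    refine (QuotientGroup.eq_one_iff (x ^ 2)).2 (Subgroup.mem_subgroupOf.2 ?_)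
    exact sq_mem_commSquares x.2
  have : Finite (N ⧸ M) := CommGroup.finite_of_fg_isMulTorsion _ tors
  have hfi : M.FiniteIndex := Subgroup.finiteIndex_iff_finite_quotient.2 this
  refine ⟨?_⟩
  rw [← Subgroup.relIndex_mul_index (commSquares_le N)]
  exact mul_ne_zero hfi.index_ne_zero Subgroup.FiniteIndex.index_ne_zero

end CommSquares

/-! ### The group `Γ`, coset maps and their automorphisms. -/

namespace MapGroup

/-- The generator `R_i` of `Γ`. -/
abbrev R (i : Fin 3) : MapGroup := PresentedGroup.of i

theorem R_sq (i : Fin 3) : R i ^ 2 = 1 :=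
  PresentedGroup.one_of_mem (rels := mapRels) (Or.inl ⟨i, rfl⟩)

theorem R_zero_mul_R_two_sq : (R 0 * R 2) ^ 2 = 1 :=
  PresentedGroup.one_of_mem (rels := mapRels) (Or.inr rfl)

theorem R_mul_self (i : Fin 3) : R i * R i = 1 := by rw [← sq, R_sq]

theorem R_inv (i : Fin 3) : (R i)⁻¹ = R i := inv_eq_of_mul_eq_one_left (R_mul_self i)

theorem closure_range_R : Subgroup.closure (Set.range R) = ⊤ :=
  PresentedGroup.closure_range_of mapRels

instance : Group.FG MapGroup :=
  Group.fg_iff.2 ⟨_, closure_range_R, Set.finite_range R⟩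

end MapGroup

open MapGroup

namespace FlagMap

@[simp] theorem rep_R (𝓜 : FlagMap) (i : Fin 3) : 𝓜.rep (R i) = 𝓜.r i :=
  PresentedGroup.toGroup.of 𝓜.lift_rels

theorem mem_mapSubgroup (𝓜 : FlagMap) {φ : 𝓜.Flag} {g : MapGroup} :
    g ∈ 𝓜.mapSubgroup φ ↔ 𝓜.rep g φ = φ := Iff.rfl

theorem range_rep (𝓜 : FlagMap) : 𝓜.rep.range = 𝓜.Mon := by
  rw [MonoidHom.range_eq_map, ← closure_range_R, MonoidHom.map_closure, ← Set.range_comp]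
  exact congrArg _ (congrArg _ (funext 𝓜.rep_R))

theorem exists_rep_eq (𝓜 : FlagMap) (φ ψ : 𝓜.Flag) : ∃ g, 𝓜.rep g φ = ψ := by
  obtain ⟨p, hp, h⟩ := 𝓜.connected φ ψ
  obtain ⟨g, rfl⟩ : p ∈ 𝓜.rep.range := 𝓜.range_rep ▸ hp
  exact ⟨g, h⟩

theorem finiteIndex_mapSubgroup (𝓜 : FlagMap) [Finite 𝓜.Flag] (φ : 𝓜.Flag) :
    (𝓜.mapSubgroup φ).FiniteIndex := by
  refine Subgroup.finiteIndex_iff_finite_quotient.2 ?_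
  refine Finite.of_injective
    (Quotient.lift (fun g => 𝓜.rep g φ) ?_ : MapGroup ⧸ 𝓜.mapSubgroup φ → 𝓜.Flag) ?_
  · intro a b hab
    have := 𝓜.mem_mapSubgroup.1 (QuotientGroup.leftRel_apply.1 hab)
    rw [map_mul, map_inv, Equiv.Perm.mul_apply, Equiv.Perm.inv_eq_iff_eq] at this
    exact this.symm
  · rintro ⟨a⟩ ⟨b⟩ hab
    refine QuotientGroup.eq.2 (𝓜.mem_mapSubgroup.2 ?_)
    rw [map_mul, map_inv, Equiv.Perm.mul_apply, Equiv.Perm.inv_eq_iff_eq]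
    exact Eq.symm hab

/-- The map whose flags are the cosets of a subgroup of `Γ`. -/
def ofSubgroup (M : Subgroup MapGroup) : FlagMap where
  Flag := MapGroup ⧸ M
  r i := MulAction.toPermHom MapGroup (MapGroup ⧸ M) (R i)
  r_sq i := by rw [← map_pow, R_sq, map_one]
  r_zero_two_sq := by rw [← map_mul, ← map_pow, R_zero_mul_R_two_sq, map_one]
  flag_nonempty := inferInstance
  connected φ ψ := by
    obtain ⟨g, rfl⟩ := MulAction.exists_smul_eq MapGroup φ ψ
    refine ⟨MulAction.toPermHom MapGroup (MapGroup ⧸ M) g, ?_, rfl⟩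
    have : g ∈ Subgroup.closure (Set.range R) := closure_range_R ▸ Subgroup.mem_top g
    have := Subgroup.mem_map_of_mem (MulAction.toPermHom MapGroup (MapGroup ⧸ M)) this
    rwa [MonoidHom.map_closure, ← Set.range_comp] at this

theorem rep_ofSubgroup (M : Subgroup MapGroup) :
    (ofSubgroup M).rep = MulAction.toPermHom MapGroup (MapGroup ⧸ M) :=
  PresentedGroup.ext fun i => (ofSubgroup M).rep_R i

/-- The flag of `ofSubgroup M` given by the coset `gM`. -/
def coset (M : Subgroup MapGroup) (g : MapGroup) : (ofSubgroup M).Flag := (g : MapGroup ⧸ M)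

theorem coset_eq {M : Subgroup MapGroup} {g h : MapGroup} :
    coset M g = coset M h ↔ g⁻¹ * h ∈ M := QuotientGroup.eq

theorem exists_coset {M : Subgroup MapGroup} (φ : (ofSubgroup M).Flag) : ∃ g, coset M g = φ :=
  QuotientGroup.mk_surjective φ

theorem rep_coset (M : Subgroup MapGroup) (g h : MapGroup) :
    (ofSubgroup M).rep g (coset M h) = coset M (g * h) := by
  rw [rep_ofSubgroup]; rfl

theorem mapSubgroup_coset_one (M : Subgroup MapGroup) :
    (ofSubgroup M).mapSubgroup (coset M 1) = M := by
  ext g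
  rw [mem_mapSubgroup, rep_coset, eq_comm, coset_eq]
  simp

theorem aut_rep_apply {𝓜 : FlagMap} (a : 𝓜.Aut) (g : MapGroup) (φ : 𝓜.Flag) :
    (a : Equiv.Perm 𝓜.Flag) (𝓜.rep g φ) = 𝓜.rep g ((a : Equiv.Perm 𝓜.Flag) φ) := by
  have hg : 𝓜.rep g ∈ 𝓜.Mon := 𝓜.range_rep ▸ ⟨g, rfl⟩
  exact (DFunLike.congr_fun (Subgroup.mem_centralizer_iff.1 a.2 _ hg) φ).symm

/-- The centraliser of a transitive group acts freely. -/
theorem aut_ext {𝓜 : FlagMap} {a b : 𝓜.Aut} {φ : 𝓜.Flag}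
    (h : (a : Equiv.Perm 𝓜.Flag) φ = (b : Equiv.Perm 𝓜.Flag) φ) : a = b := by
  ext ψ
  obtain ⟨g, rfl⟩ := 𝓜.exists_rep_eq φ ψ
  rw [aut_rep_apply, aut_rep_apply, h]

/-- An automorphism of `ofSubgroup M` is `gM ↦ gnM` for an element `n` normalising `M`. -/
theorem exists_aut_apply_coset {M : Subgroup MapGroup} (a : (ofSubgroup M).Aut) :
    ∃ n ∈ Subgroup.normalizer (M : Set MapGroup),
      ∀ g, (a : Equiv.Perm (ofSubgroup M).Flag) (coset M g) = coset M (g * n) := by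
  obtain ⟨n, hn⟩ := exists_coset ((a : Equiv.Perm (ofSubgroup M).Flag) (coset M 1))
  have key : ∀ g, (a : Equiv.Perm (ofSubgroup M).Flag) (coset M g) = coset M (g * n) := by
    intro g
    rw [← mul_one g, ← rep_coset, aut_rep_apply, ← hn, rep_coset, mul_one]
  refine ⟨n, Subgroup.mem_normalizer_iff''.2 fun m => ?_, key⟩
  have h1 : coset M 1 = coset M m ↔ m ∈ M := by rw [coset_eq]; simp
  have h2 : coset M (1 * n) = coset M (m * n) ↔ n⁻¹ * m * n ∈ M := by
    rw [coset_eq]; simp [mul_assoc]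
  change m ∈ M ↔ n⁻¹ * m * n ∈ M
  rw [← h1, ← h2, ← key, ← key, Equiv.apply_eq_iff_eq]

/-- Right multiplication by an element normalising `M` is an automorphism of `ofSubgroup M`. -/
theorem exists_aut_of_mem_normalizer {M : Subgroup MapGroup} {n : MapGroup}
    (hn : n ∈ Subgroup.normalizer (M : Set MapGroup)) :
    ∃ a : (ofSubgroup M).Aut,
      ∀ g, (a : Equiv.Perm (ofSubgroup M).Flag) (coset M g) = coset M (g * n) := by
  have aux : ∀ n ∈ Subgroup.normalizer (M : Set MapGroup), ∀ a b : MapGroup,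
      (QuotientGroup.leftRel M) a b →
        ((a * n : MapGroup) : MapGroup ⧸ M) = ((b * n : MapGroup) : MapGroup ⧸ M) := by
    intro n hn a b hab
    rw [QuotientGroup.eq]
    have := (Subgroup.mem_normalizer_iff''.1 hn _).1 (QuotientGroup.leftRel_apply.1 hab)
    simpa [mul_assoc] using this
  let f : ∀ n ∈ Subgroup.normalizer (M : Set MapGroup), MapGroup ⧸ M → MapGroup ⧸ M :=
    fun n hn => Quotient.lift (fun g => ((g * n : MapGroup) : MapGroup ⧸ M)) (aux n hn)
  let p : Equiv.Perm (ofSubgroup M).Flag :=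
    { toFun := f n hn
      invFun := f n⁻¹ (Subgroup.inv_mem _ hn)
      left_inv := by
        rintro ⟨g⟩
        exact congrArg (QuotientGroup.mk (s := M)) (mul_inv_cancel_right g n)
      right_inv := by
        rintro ⟨g⟩
        exact congrArg (QuotientGroup.mk (s := M)) (inv_mul_cancel_right g n) }
  refine ⟨⟨p, Subgroup.mem_centralizer_iff.2 ?_⟩, fun g => rfl⟩
  intro q hq
  obtain ⟨g, rfl⟩ : q ∈ (ofSubgroup M).rep.range := (ofSubgroup M).range_rep ▸ hq
  ext φ
  obtain ⟨x, rfl⟩ := exists_coset φ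
  have hp : ∀ y, p (coset M y) = coset M (y * n) := fun _ => rfl
  simp only [Equiv.Perm.mul_apply, rep_coset, hp, mul_assoc]

end FlagMap

/-! ### Voltages at the boundary sides. -/

namespace FlagMap

theorem zmodTwo_add_self {X : Type*} (v : X → ZMod 2) : v + v = 0 :=
  funext fun x => CharTwo.add_self_eq_zero (v x)

section Voltage

variable (𝓑 : FlagMap)

theorem r_r (i : Fin 3) (φ : 𝓑.Flag) : 𝓑.r i (𝓑.r i φ) = φ := by
  rw [← Equiv.Perm.mul_apply, ← sq, 𝓑.r_sq, Equiv.Perm.one_apply]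

theorem r_zero_r_two (φ : 𝓑.Flag) : 𝓑.r 0 (𝓑.r 2 φ) = 𝓑.r 2 (𝓑.r 0 φ) := by
  have h := DFunLike.congr_fun 𝓑.r_zero_two_sq (𝓑.r 2 (𝓑.r 0 φ))
  simpa [sq, r_r] using h

/-- The generator other than `r i` that commutes with `r i`, if there is one. -/
def mate (i : Fin 3) : Equiv.Perm 𝓑.Flag := ![𝓑.r 2, 1, 𝓑.r 0] i

@[simp] theorem mate_zero : 𝓑.mate 0 = 𝓑.r 2 := rfl
@[simp] theorem mate_one : 𝓑.mate 1 = 1 := rfl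
@[simp] theorem mate_two : 𝓑.mate 2 = 𝓑.r 0 := rfl

/-- The side of the flag `φ` in which `r i` reflects. -/
def side (i : Fin 3) (φ : 𝓑.Flag) : Fin 3 × Sym2 𝓑.Flag := (i, s(φ, 𝓑.mate i φ))

/-- The boundary sides of type `i`. -/
def boundarySides (i : Fin 3) : Set (Fin 3 × Sym2 𝓑.Flag) := 𝓑.side i '' {φ | 𝓑.r i φ = φ}

open Classical in
/-- The voltage of `R_i` at `φ`: the basis vector belonging to the side, if this is a
boundary side. -/
noncomputable def label (i : Fin 3) (φ : 𝓑.Flag) : Fin 3 × Sym2 𝓑.Flag → ZMod 2 :=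
  if 𝓑.r i φ = φ then Pi.single (𝓑.side i φ) 1 else 0

theorem label_r (i : Fin 3) (φ : 𝓑.Flag) : 𝓑.label i (𝓑.r i φ) = 𝓑.label i φ := by
  by_cases h : 𝓑.r i φ = φ
  · rw [h]
  · rw [label, label, r_r, if_neg h, if_neg (Ne.symm h)]

/-- The flags `φ` and `r 2 φ` share their side of type 0. With its twin for `r 0`, this makes the
lifted generators satisfy `(R₀R₂)² = 1`. -/
theorem label_zero_r_two (φ : 𝓑.Flag) : 𝓑.label 0 (𝓑.r 2 φ) = 𝓑.label 0 φ := by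
  have h : 𝓑.r 0 (𝓑.r 2 φ) = 𝓑.r 2 φ ↔ 𝓑.r 0 φ = φ := by
    rw [r_zero_r_two, Equiv.apply_eq_iff_eq]
  have hs : 𝓑.side 0 (𝓑.r 2 φ) = 𝓑.side 0 φ := by
    simp [side, r_r, Sym2.eq_swap]
  by_cases hφ : 𝓑.r 0 φ = φ
  · rw [label, label, if_pos (h.2 hφ), if_pos hφ, hs]
  · rw [label, label, if_neg (mt h.1 hφ), if_neg hφ]

theorem label_two_r_zero (φ : 𝓑.Flag) : 𝓑.label 2 (𝓑.r 0 φ) = 𝓑.label 2 φ := by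
  have h : 𝓑.r 2 (𝓑.r 0 φ) = 𝓑.r 0 φ ↔ 𝓑.r 2 φ = φ := by
    rw [← r_zero_r_two, Equiv.apply_eq_iff_eq]
  have hs : 𝓑.side 2 (𝓑.r 0 φ) = 𝓑.side 2 φ := by
    simp [side, r_r, Sym2.eq_swap]
  by_cases hφ : 𝓑.r 2 φ = φ
  · rw [label, label, if_pos (h.2 hφ), if_pos hφ, hs]
  · rw [label, label, if_neg (mt h.1 hφ), if_neg hφ]

/-- The action of `R_i` on the double cover of `𝓑` branched in its boundary sides. -/
noncomputable def liftPerm (i : Fin 3) :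
    Equiv.Perm (𝓑.Flag × (Fin 3 × Sym2 𝓑.Flag → ZMod 2)) :=
  Function.Involutive.toPerm (fun p => (𝓑.r i p.1, p.2 + 𝓑.label i p.1)) fun p => by
    simp [r_r, label_r, add_assoc, zmodTwo_add_self]

theorem liftPerm_apply (i : Fin 3) (φ : 𝓑.Flag) (v : Fin 3 × Sym2 𝓑.Flag → ZMod 2) :
    𝓑.liftPerm i (φ, v) = (𝓑.r i φ, v + 𝓑.label i φ) := rfl

theorem liftPerm_rels : ∀ w ∈ mapRels, FreeGroup.lift 𝓑.liftPerm w = 1 := by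
  rintro w (⟨i, rfl⟩ | rfl)
  · ext1 ⟨φ, v⟩
    simp [sq, liftPerm_apply, r_r, label_r, add_assoc, zmodTwo_add_self]
  · ext1 ⟨φ, v⟩
    simp only [sq, map_mul, FreeGroup.lift_apply_of, Equiv.Perm.mul_apply, liftPerm_apply,
      label_zero_r_two, label_two_r_zero, label_r, r_r, ← r_zero_r_two, Equiv.Perm.one_apply]
    have : ∀ u w : Fin 3 × Sym2 𝓑.Flag → ZMod 2, v + u + w + u + w = v := by
      intro u w
      have hu := zmodTwo_add_self u
      have hw := zmodTwo_add_self w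
      linear_combination hu + hw
    rw [this]

/-- The action of `Γ` on the double cover. -/
noncomputable def liftRep :
    MapGroup →* Equiv.Perm (𝓑.Flag × (Fin 3 × Sym2 𝓑.Flag → ZMod 2)) :=
  PresentedGroup.toGroup 𝓑.liftPerm_rels

/-- The voltage of an element of `Γ` at a flag. -/
noncomputable def volt (g : MapGroup) (φ : 𝓑.Flag) : Fin 3 × Sym2 𝓑.Flag → ZMod 2 :=
  (𝓑.liftRep g (φ, 0)).2

theorem liftRep_R (i : Fin 3) : 𝓑.liftRep (R i) = 𝓑.liftPerm i :=
  PresentedGroup.toGroup.of 𝓑.liftPerm_rels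

theorem liftRep_apply (g : MapGroup) :
    ∀ φ v, 𝓑.liftRep g (φ, v) = (𝓑.rep g φ, v + 𝓑.volt g φ) := by
  have hg : g ∈ Subgroup.closure (Set.range R) := closure_range_R ▸ Subgroup.mem_top g
  induction hg using Subgroup.closure_induction with
  | mem x hx =>
    obtain ⟨i, rfl⟩ := hx
    intro φ v
    simp [volt, liftRep_R, liftPerm_apply]
  | one => simp [volt]
  | mul x y _ _ hx hy =>
    intro φ v
    have h : ∀ v, 𝓑.liftRep (x * y) (φ, v) =
        (𝓑.rep (x * y) φ, v + 𝓑.volt y φ + 𝓑.volt x (𝓑.rep y φ)) := by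
      intro v
      simp only [map_mul, Equiv.Perm.mul_apply, hx, hy]
    rw [volt, h, h, zero_add, add_assoc]
  | inv x _ hx =>
    intro φ v
    have h : ∀ v, 𝓑.liftRep x⁻¹ (φ, v) = (𝓑.rep x⁻¹ φ, v - 𝓑.volt x (𝓑.rep x⁻¹ φ)) := by
      intro v
      rw [map_inv, Equiv.Perm.inv_eq_iff_eq, hx]
      simp
    rw [volt, h, h, zero_sub, sub_eq_add_neg]

/-- The cocycle rule; on the stabiliser of `φ` it makes the voltage at `φ` a homomorphism. -/
theorem volt_mul (g h : MapGroup) (φ : 𝓑.Flag) :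
    𝓑.volt (g * h) φ = 𝓑.volt h φ + 𝓑.volt g (𝓑.rep h φ) := by
  rw [volt, map_mul, Equiv.Perm.mul_apply, liftRep_apply, liftRep_apply, zero_add]

theorem volt_one (φ : 𝓑.Flag) : 𝓑.volt 1 φ = 0 := by simp [volt]

theorem volt_R (i : Fin 3) (φ : 𝓑.Flag) : 𝓑.volt (R i) φ = 𝓑.label i φ := by
  simp [volt, liftRep_R, liftPerm_apply]

theorem volt_inv_add (g : MapGroup) (φ : 𝓑.Flag) :
    𝓑.volt g⁻¹ (𝓑.rep g φ) + 𝓑.volt g φ = 0 := by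
  rw [add_comm, ← volt_mul, inv_mul_cancel, volt_one]

/-- A homomorphism into an abelian group of exponent 2 kills commutators and squares. -/
theorem volt_eq_zero_of_mem_commSquares {φ : 𝓑.Flag} {m : MapGroup}
    (hm : m ∈ commSquares (𝓑.mapSubgroup φ)) : 𝓑.volt m φ = 0 := by
  have hmul : ∀ x y, y ∈ 𝓑.mapSubgroup φ → 𝓑.volt (x * y) φ = 𝓑.volt x φ + 𝓑.volt y φ := by
    intro x y hy
    rw [volt_mul, 𝓑.mem_mapSubgroup.1 hy, add_comm]
  have hinv : ∀ x ∈ 𝓑.mapSubgroup φ, 𝓑.volt x⁻¹ φ = 𝓑.volt x φ := by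
    intro x hx
    have h := 𝓑.volt_inv_add x φ
    rw [𝓑.mem_mapSubgroup.1 hx] at h
    linear_combination h - zmodTwo_add_self (𝓑.volt x φ)
  induction hm using Subgroup.closure_induction with
  | mem z hz =>
    rcases hz with ⟨x, hx, y, hy, rfl⟩ | ⟨x, hx, rfl⟩
    · rw [hmul _ _ (inv_mem hy), hmul _ _ (inv_mem hx), hmul _ _ hy, hinv x hx, hinv y hy]
      linear_combination zmodTwo_add_self (𝓑.volt x φ) +
        zmodTwo_add_self (𝓑.volt y φ)
    · rw [sq, hmul _ _ hx, zmodTwo_add_self]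
  | one => exact 𝓑.volt_one φ
  | mul x y _ hy' hx hy => rw [hmul x y (commSquares_le _ hy'), hx, hy, add_zero]
  | inv x hx' hx => rw [hinv x (commSquares_le _ hx'), hx]

theorem conj_R_mem_mapSubgroup {φ : 𝓑.Flag} {g : MapGroup} {i : Fin 3} :
    g⁻¹ * R i * g ∈ 𝓑.mapSubgroup φ ↔ 𝓑.r i (𝓑.rep g φ) = 𝓑.rep g φ := by
  rw [mem_mapSubgroup, map_mul, map_mul, map_inv, Equiv.Perm.mul_apply, Equiv.Perm.mul_apply,
    Equiv.Perm.inv_eq_iff_eq, rep_R]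

open Classical in
theorem volt_conj_R {φ : 𝓑.Flag} {g : MapGroup} {i : Fin 3}
    (h : 𝓑.r i (𝓑.rep g φ) = 𝓑.rep g φ) :
    𝓑.volt (g⁻¹ * R i * g) φ = Pi.single (𝓑.side i (𝓑.rep g φ)) 1 := by
  rw [volt_mul, volt_mul, volt_R, label, if_pos h, rep_R, h]
  linear_combination 𝓑.volt_inv_add g φ

/-- Two conjugates of `R_i` belonging to the same side are congruent modulo `N'N²`. -/
theorem conj_R_congr {φ : 𝓑.Flag} {g h : MapGroup} {i : Fin 3}
    (hg : 𝓑.r i (𝓑.rep g φ) = 𝓑.rep g φ)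
    (hgh : 𝓑.side i (𝓑.rep g φ) = 𝓑.side i (𝓑.rep h φ)) :
    (g⁻¹ * R i * g)⁻¹ * (h⁻¹ * R i * h) ∈ commSquares (𝓑.mapSubgroup φ) := by
  -- Flags on the same side agree up to the generator commuting with `R i`. With `k = (z * g)⁻¹ * h`
  -- in `N`, the second conjugate of `R i` is the first one conjugated by `k`, so the two differ by
  -- a commutator.
  obtain ⟨z, hz, hzg⟩ : ∃ z, Commute z (R i) ∧ 𝓑.rep h φ = 𝓑.rep (z * g) φ := by
    have comm02 : Commute (R 0) (R 2) := by
      have h := R_zero_mul_R_two_sq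
      rw [sq] at h
      have := eq_inv_of_mul_eq_one_left h
      rwa [mul_inv_rev, R_inv, R_inv] at this
    have h1 : 𝓑.rep g φ = 𝓑.rep h φ ∨ 𝓑.rep h φ = 𝓑.mate i (𝓑.rep g φ) := by
      have := (Prod.ext_iff.1 hgh).2
      simp only [side, Sym2.eq_iff] at this
      rcases this with h | h
      · exact Or.inl h.1
      · exact Or.inr h.2.symm
    rcases h1 with h1 | h1
    · exact ⟨1, Commute.one_left _, by rw [one_mul, h1]⟩
    · fin_cases i
      · exact ⟨R 2, comm02.symm, by rw [h1, map_mul, rep_R]; rfl⟩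
      · exact ⟨1, Commute.one_left _, by rw [h1, one_mul]; rfl⟩
      · exact ⟨R 0, comm02, by rw [h1, map_mul, rep_R]; rfl⟩
  have hk : (z * g)⁻¹ * h ∈ 𝓑.mapSubgroup φ := by
    rw [mem_mapSubgroup, map_mul, map_inv, Equiv.Perm.mul_apply, Equiv.Perm.inv_eq_iff_eq, hzg]
  have hx := 𝓑.conj_R_mem_mapSubgroup.2 hg
  have key := commutator_mem_commSquares (inv_mem hx) (inv_mem hk)
  convert key using 1
  simp only [mul_inv_rev, inv_inv, mul_assoc, mul_inv_cancel_left]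
  have hzh : z * (R i * (z⁻¹ * h)) = R i * h := by
    rw [← mul_assoc, hz.eq, mul_assoc, mul_inv_cancel_left]
  rw [R_inv, hzh]

end Voltage

end FlagMap

/-! ### Rigid flags and the reflections of the cover `squareCover`. -/

namespace FlagMap

variable (𝓑 : FlagMap) (φ : 𝓑.Flag)

/-- The flag `φ` is rigid if no other flag `ψ` is such that, for all `t` in `Γ`, the squares of the
elements fixing `tφ` fix `tψ`, and conversely. -/
def IsRigid : Prop :=
  ∀ ψ : 𝓑.Flag,
    (∀ t w, 𝓑.rep w (𝓑.rep t φ) = 𝓑.rep t φ → 𝓑.rep (w ^ 2) (𝓑.rep t ψ) = 𝓑.rep t ψ) →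
    (∀ t w, 𝓑.rep w (𝓑.rep t ψ) = 𝓑.rep t ψ → 𝓑.rep (w ^ 2) (𝓑.rep t φ) = 𝓑.rep t φ) → ψ = φ

variable {𝓑 φ}

/-- If `g` normalises `N'N²`, the square of any element fixing `φ` or `gφ` lies in the stabiliser of
the other. Transporting this by every `t` gives the two conditions of rigidity for `ψ = gφ`. -/
theorem IsRigid.normalizer_eq (h : 𝓑.IsRigid φ) :
    Subgroup.normalizer (commSquares (𝓑.mapSubgroup φ) : Set MapGroup) = 𝓑.mapSubgroup φ := by
  refine le_antisymm (fun g hg => ?_) (le_normalizer_commSquares _)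
  have fix : ∀ {x : MapGroup} {ψ : 𝓑.Flag} (t w : MapGroup), x = t⁻¹ * w * t →
      (𝓑.rep x ψ = ψ ↔ 𝓑.rep w (𝓑.rep t ψ) = 𝓑.rep t ψ) := by
    rintro x ψ t w rfl
    rw [map_mul, map_mul, map_inv, Equiv.Perm.mul_apply, Equiv.Perm.mul_apply,
      Equiv.Perm.inv_eq_iff_eq]
  have fixM : ∀ {m : MapGroup}, m ∈ commSquares (𝓑.mapSubgroup φ) → 𝓑.rep m φ = φ :=
    fun hm => commSquares_le _ hm
  refine 𝓑.mem_mapSubgroup.2 (h _ (fun t w hw => ?_) fun t w hw => ?_)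
  · have hm := sq_mem_commSquares (𝓑.mem_mapSubgroup.2 ((fix t w rfl).2 hw))
    have := fixM ((Subgroup.mem_normalizer_iff''.1 hg _).1 hm)
    refine (fix (x := t⁻¹ * w ^ 2 * t) t (w ^ 2) rfl).1 ?_
    refine (fix g _ ?_).1 this
    simp [sq, mul_assoc]
  · have h1 := (fix (x := g⁻¹ * (t⁻¹ * w * t) * g) g _ rfl).2 ((fix t w rfl).2 hw)
    have hm := sq_mem_commSquares (𝓑.mem_mapSubgroup.2 h1)
    have hm' : g⁻¹ * (t⁻¹ * w ^ 2 * t) * g ∈ commSquares (𝓑.mapSubgroup φ) := by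
      convert hm using 1
      simp [sq, mul_assoc]
    exact (fix t _ rfl).1 (fixM ((Subgroup.mem_normalizer_iff''.1 hg _).2 hm'))

variable (𝓑 φ)

/-- The map with map subgroup `N'N²`, where `N` is the stabiliser of the flag `φ` of `𝓑`. -/
abbrev squareCover : FlagMap := ofSubgroup (commSquares (𝓑.mapSubgroup φ))

variable {𝓑 φ}

theorem IsRigid.exists_aut_apply (h : 𝓑.IsRigid φ) (a : (𝓑.squareCover φ).Aut) :
    ∃ n ∈ 𝓑.mapSubgroup φ, ∀ g, (a : Equiv.Perm (𝓑.squareCover φ).Flag) (coset _ g) =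
      coset _ (g * n) := by
  obtain ⟨n, hn, hna⟩ := exists_aut_apply_coset a
  exact ⟨n, h.normalizer_eq ▸ hn, hna⟩

theorem IsRigid.aut_comm (h : 𝓑.IsRigid φ) (a b : (𝓑.squareCover φ).Aut) : a * b = b * a := by
  obtain ⟨m, hm, ha⟩ := h.exists_aut_apply a
  obtain ⟨n, hn, hb⟩ := h.exists_aut_apply b
  refine aut_ext (φ := coset _ 1) ?_
  simp only [Subgroup.coe_mul, Equiv.Perm.mul_apply, ha, hb, coset_eq]
  simpa [mul_assoc] using commutator_mem_commSquares (inv_mem hm) (inv_mem hn)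

theorem IsRigid.mk_injective (h : 𝓑.IsRigid φ) :
    Function.Injective (ConjClasses.mk : (𝓑.squareCover φ).Aut → _) := by
  intro a b hab
  obtain ⟨c, hc⟩ := isConj_iff.1 (ConjClasses.mk_eq_mk_iff_isConj.1 hab)
  rw [← hc, h.aut_comm c a, mul_inv_cancel_right]

/-- The element of `N` describing an automorphism of `squareCover`. -/
noncomputable def IsRigid.elt (h : 𝓑.IsRigid φ) (a : (𝓑.squareCover φ).Aut) : MapGroup :=
  (h.exists_aut_apply a).choose

theorem IsRigid.elt_mem (h : 𝓑.IsRigid φ) (a : (𝓑.squareCover φ).Aut) :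
    h.elt a ∈ 𝓑.mapSubgroup φ := (h.exists_aut_apply a).choose_spec.1

theorem IsRigid.apply_coset (h : 𝓑.IsRigid φ) (a : (𝓑.squareCover φ).Aut) (g : MapGroup) :
    (a : Equiv.Perm (𝓑.squareCover φ).Flag) (coset _ g) = coset _ (g * h.elt a) :=
  (h.exists_aut_apply a).choose_spec.2 g

/-- The vector in the homology of the base map describing an automorphism of `squareCover`. -/
noncomputable def IsRigid.vec (h : 𝓑.IsRigid φ) (a : (𝓑.squareCover φ).Aut) :
    Fin 3 × Sym2 𝓑.Flag → ZMod 2 := 𝓑.volt (h.elt a) φ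

theorem IsRigid.vec_eq (h : 𝓑.IsRigid φ) {a : (𝓑.squareCover φ).Aut} {n : MapGroup}
    (ha : n⁻¹ * h.elt a ∈ commSquares (𝓑.mapSubgroup φ)) : h.vec a = 𝓑.volt n φ := by
  have : h.elt a = n * (n⁻¹ * h.elt a) := by simp
  rw [vec, this, volt_mul, volt_eq_zero_of_mem_commSquares 𝓑 ha, zero_add,
    𝓑.mem_mapSubgroup.1 (commSquares_le _ ha)]

/-- Comparing the cosets `R_i gM` and `gnM` gives `n ≡ g⁻¹ R_i g` mod `M`; as `n` is in `N`, so is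
this conjugate. -/
theorem IsRigid.reflection_spec (h : 𝓑.IsRigid φ) {a : (𝓑.squareCover φ).Aut} {i : Fin 3}
    {g : MapGroup}
    (ha : (a : Equiv.Perm (𝓑.squareCover φ).Flag) (coset _ g) =
      (𝓑.squareCover φ).r i (coset _ g)) :
    𝓑.r i (𝓑.rep g φ) = 𝓑.rep g φ ∧
      (g⁻¹ * R i * g)⁻¹ * h.elt a ∈ commSquares (𝓑.mapSubgroup φ) := by
  rw [h.apply_coset, ← rep_R, rep_coset, eq_comm, coset_eq] at ha
  have h1 : (g⁻¹ * R i * g)⁻¹ * h.elt a ∈ commSquares (𝓑.mapSubgroup φ) := by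
    simpa [mul_assoc, R_inv] using ha
  refine ⟨𝓑.conj_R_mem_mapSubgroup.1 ?_, h1⟩
  have := (𝓑.mapSubgroup φ).mul_mem (h.elt_mem a) (inv_mem (commSquares_le _ h1))
  simpa [mul_assoc] using this

open Classical in
theorem IsRigid.isReflectionOfType_iff (h : 𝓑.IsRigid φ) {a : (𝓑.squareCover φ).Aut} {i : Fin 3} :
    (𝓑.squareCover φ).IsReflectionOfType i a ↔
      ∃ g, 𝓑.r i (𝓑.rep g φ) = 𝓑.rep g φ ∧
        (g⁻¹ * R i * g)⁻¹ * h.elt a ∈ commSquares (𝓑.mapSubgroup φ) := by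
  constructor
  · rintro ⟨-, ψ, hψ⟩
    obtain ⟨g, rfl⟩ := exists_coset ψ
    exact ⟨g, h.reflection_spec hψ⟩
  · rintro ⟨g, hg, hga⟩
    refine ⟨?_, coset _ g, ?_⟩
    -- The identity has voltage `0`, whereas the conjugate of `R i` has a basis vector as voltage.
    · rintro rfl
      have h1 := h.apply_coset 1 1
      rw [Subgroup.coe_one, Equiv.Perm.one_apply, coset_eq, inv_one, one_mul, one_mul] at h1
      have h2 := h.vec_eq hga
      rw [volt_conj_R 𝓑 hg, vec, volt_eq_zero_of_mem_commSquares 𝓑 h1] at h2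
      exact one_ne_zero (Pi.single_eq_zero_iff.1 h2.symm)
    · rw [h.apply_coset, ← rep_R, rep_coset, eq_comm, coset_eq]
      simpa [mul_assoc, R_inv] using hga

open Classical in
theorem IsRigid.vec_of_reflection (h : 𝓑.IsRigid φ) {a : (𝓑.squareCover φ).Aut} {i : Fin 3}
    (ha : (𝓑.squareCover φ).IsReflectionOfType i a) :
    ∃ b ∈ 𝓑.boundarySides i, h.vec a = Pi.single b 1 := by
  obtain ⟨g, hg, hga⟩ := h.isReflectionOfType_iff.1 ha
  exact ⟨_, ⟨_, hg, rfl⟩, (h.vec_eq hga).trans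
    (𝓑.volt_conj_R hg)⟩

theorem single_one_injective {X : Type*} [DecidableEq X] {b c : X}
    (h : (Pi.single b 1 : X → ZMod 2) = Pi.single c 1) : b = c := by
  by_contra hbc
  have := congrFun h b
  rw [Pi.single_eq_same, Pi.single_eq_of_ne hbc] at this
  exact one_ne_zero this

/-- The voltage recovers the side, and the side determines the conjugate of `R i` modulo `N'N²`. -/
theorem IsRigid.vec_injOn (h : 𝓑.IsRigid φ) (i : Fin 3) :
    Set.InjOn h.vec {a | (𝓑.squareCover φ).IsReflectionOfType i a} := by
  classical
  intro a ha b hb hab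
  obtain ⟨g, hg, hga⟩ := h.isReflectionOfType_iff.1 ha
  obtain ⟨k, hk, hkb⟩ := h.isReflectionOfType_iff.1 hb
  rw [h.vec_eq hga, 𝓑.volt_conj_R hg,
    h.vec_eq hkb, 𝓑.volt_conj_R hk] at hab
  have hgk := 𝓑.conj_R_congr hg (single_one_injective hab)
  refine aut_ext (φ := coset _ 1) ?_
  rw [h.apply_coset, h.apply_coset, coset_eq, one_mul, one_mul]
  have := mul_mem (mul_mem (inv_mem hga) hgk) hkb
  simpa [mul_assoc] using this

open Classical in
theorem IsRigid.vec_image (h : 𝓑.IsRigid φ) (i : Fin 3) :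
    h.vec '' {a | (𝓑.squareCover φ).IsReflectionOfType i a} =
      (fun b => Pi.single b 1) '' 𝓑.boundarySides i := by
  apply Set.Subset.antisymm
  · rintro _ ⟨a, ha, rfl⟩
    obtain ⟨b, hb, hab⟩ := h.vec_of_reflection ha
    exact ⟨b, hb, hab.symm⟩
  · rintro _ ⟨_, ⟨ψ, hψ, rfl⟩, rfl⟩
    obtain ⟨g, rfl⟩ := 𝓑.exists_rep_eq φ ψ
    have hmem := 𝓑.conj_R_mem_mapSubgroup.2 hψ
    obtain ⟨a, ha⟩ := exists_aut_of_mem_normalizer (le_normalizer_commSquares _ hmem)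
    have ha1 := (ha 1).symm.trans (h.apply_coset a 1)
    rw [coset_eq] at ha1
    have hga : (g⁻¹ * R i * g)⁻¹ * h.elt a ∈ commSquares (𝓑.mapSubgroup φ) := by
      simpa using ha1
    exact ⟨a, h.isReflectionOfType_iff.2 ⟨g, hψ, hga⟩,
      (h.vec_eq hga).trans (𝓑.volt_conj_R hψ)⟩

theorem IsRigid.encard_reflections (h : 𝓑.IsRigid φ) (i : Fin 3) :
    {a | (𝓑.squareCover φ).IsReflectionOfType i a}.encard = (𝓑.boundarySides i).encard := by
  classical
  rw [← (h.vec_injOn i).encard_image, h.vec_image,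
    Set.InjOn.encard_image fun b _ c _ hbc => single_one_injective hbc]

theorem IsRigid.crType_squareCover (h : 𝓑.IsRigid φ) (i : Fin 3) :
    (𝓑.squareCover φ).crType i = (𝓑.boundarySides i).encard := by
  rw [crType, h.mk_injective.encard_image, h.encard_reflections]

theorem IsRigid.disjoint_reflections (h : 𝓑.IsRigid φ) {i j : Fin 3} (hij : i ≠ j) :
    Disjoint {a | (𝓑.squareCover φ).IsReflectionOfType i a}
      {a | (𝓑.squareCover φ).IsReflectionOfType j a} := by
  classical
  refine Set.disjoint_left.2 fun a hai haj => hij ?_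
  obtain ⟨_, ⟨_, -, rfl⟩, hb⟩ := h.vec_of_reflection hai
  obtain ⟨_, ⟨_, -, rfl⟩, hc⟩ := h.vec_of_reflection haj
  exact congrArg Prod.fst (single_one_injective (hb.symm.trans hc))

theorem IsRigid.cr_squareCover (h : 𝓑.IsRigid φ) :
    (𝓑.squareCover φ).cr = (𝓑.boundarySides 0).encard + (𝓑.boundarySides 1).encard +
      (𝓑.boundarySides 2).encard := by
  have union : {a | (𝓑.squareCover φ).IsReflection a} =
      ({a | (𝓑.squareCover φ).IsReflectionOfType 0 a} ∪
        {a | (𝓑.squareCover φ).IsReflectionOfType 1 a}) ∪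
        {a | (𝓑.squareCover φ).IsReflectionOfType 2 a} := by
    ext a
    simp [IsReflection, Fin.exists_fin_succ, or_assoc]
  rw [cr, h.mk_injective.encard_image, union, Set.encard_union_eq, Set.encard_union_eq,
    h.encard_reflections, h.encard_reflections, h.encard_reflections]
  · exact h.disjoint_reflections (by decide)
  · exact Set.disjoint_union_left.2
      ⟨h.disjoint_reflections (by decide), h.disjoint_reflections (by decide)⟩

theorem finite_squareCover [Finite 𝓑.Flag] : Finite (𝓑.squareCover φ).Flag := by
  have := 𝓑.finiteIndex_mapSubgroup φ
  exact Subgroup.finiteIndex_iff_finite_quotient.1 (finiteIndex_commSquares (𝓑.mapSubgroup φ))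

end FlagMap

theorem exists_map_of_isRigid {𝓑 : FlagMap} [Finite 𝓑.Flag] {φ : 𝓑.Flag} (h : 𝓑.IsRigid φ)
    {c₀ c₁ c₂ : ℕ} (h₀ : (𝓑.boundarySides 0).encard = c₀)
    (h₁ : (𝓑.boundarySides 1).encard = c₁) (h₂ : (𝓑.boundarySides 2).encard = c₂) :
    ∃ (𝓜 : FlagMap) (φ : 𝓜.Flag) (N : Subgroup MapGroup),
      Finite 𝓜.Flag ∧
      (𝓜.crType 0 = c₀ ∧ 𝓜.crType 1 = c₁ ∧ 𝓜.crType 2 = c₂ ∧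
        𝓜.cr = c₀ + c₁ + c₂) ∧
      N.FiniteIndex ∧
      𝓜.mapSubgroup φ = commSquares N ∧
      Subgroup.normalizer (𝓜.mapSubgroup φ : Set MapGroup) = N := by
  refine ⟨𝓑.squareCover φ, FlagMap.coset _ 1, 𝓑.mapSubgroup φ, FlagMap.finite_squareCover,
    ⟨?_, ?_, ?_, ?_⟩, 𝓑.finiteIndex_mapSubgroup φ, FlagMap.mapSubgroup_coset_one _, ?_⟩
  · rw [h.crType_squareCover, h₀]
  · rw [h.crType_squareCover, h₁]
  · rw [h.crType_squareCover, h₂]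
  · rw [h.cr_squareCover, h₀, h₁, h₂]
  · rw [FlagMap.mapSubgroup_coset_one, h.normalizer_eq]

/-! ### Strip maps: rigidity and boundary sides. -/

/-- Data for a map built from a cyclic strip of flags `ZMod n`, on which `r₁` is `x ↦ 1 - x` and
`r₀r₂` is `x ↦ -x`; `r₀` is `ρ` outside `D`, and joins the flags in `D` to additional flags. Of the
additional flags those in `E` are fixed by `r₁`. -/
structure StripData where
  n : ℕ
  four_lt : 4 < n
  D : Set (ZMod n)
  E : Set (ZMod n)
  ρ : ZMod n → ZMod n
  neg_mem_D : ∀ x ∈ D, -x ∈ D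
  neg_mem_E : ∀ x ∈ E, -x ∈ E
  E_subset : E ⊆ D
  -- Ensures that `r₁` fixes no additional flag outside `E`.
  neg_ne : ∀ x ∈ D, -x ≠ x
  ρ_ρ : ∀ x, ρ (ρ x) = x
  ρ_neg : ∀ x, ρ (-x) = -ρ x
  ρ_mem_D : ∀ x, ρ x ∈ D → x ∈ D
  aperiodic : ∀ j, (∀ x, x ∈ D ↔ x + j ∈ D) → j = 0

namespace StripData

variable (S : StripData)

open Classical in
/-- The generator `r₀`. -/
noncomputable def r₀ : Equiv.Perm (ZMod S.n ⊕ S.D) :=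
  Function.Involutive.toPerm
    (Sum.elim (fun x => if h : x ∈ S.D then Sum.inr ⟨x, h⟩ else Sum.inl (S.ρ x))
      fun x => Sum.inl x) <| by
    rintro (x | x)
    · by_cases h : x ∈ S.D
      · simp [h]
      · have : S.ρ x ∉ S.D := fun hx => h (S.ρ_mem_D x hx)
        simp [h, this, S.ρ_ρ]
    · simp

/-- The product `r₀r₂`. -/
def z : Equiv.Perm (ZMod S.n ⊕ S.D) :=
  Function.Involutive.toPerm
    (Sum.map (fun x => -x) fun x => ⟨-x, S.neg_mem_D x x.2⟩) <| by
    rintro (x | x) <;> simp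

open Classical in
/-- The generator `r₁`. -/
noncomputable def r₁ : Equiv.Perm (ZMod S.n ⊕ S.D) :=
  Function.Involutive.toPerm
    (Sum.map (fun x => 1 - x) fun x => if (x : ZMod S.n) ∈ S.E then x
      else ⟨-x, S.neg_mem_D x x.2⟩) <| by
    rintro (x | x)
    · simp
    · by_cases h : (x : ZMod S.n) ∈ S.E
      · simp [h]
      · have : -(x : ZMod S.n) ∉ S.E := fun hx => h (by simpa using S.neg_mem_E _ hx)
        simp [h, this]

theorem r₀_inl_of_mem {x : ZMod S.n} (h : x ∈ S.D) : S.r₀ (Sum.inl x) = Sum.inr ⟨x, h⟩ := by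
  simp [r₀, Function.Involutive.toPerm, h]

theorem r₀_inl_of_notMem {x : ZMod S.n} (h : x ∉ S.D) :
    S.r₀ (Sum.inl x) = Sum.inl (S.ρ x) := by
  simp [r₀, Function.Involutive.toPerm, h]

theorem r₀_inr (x : S.D) : S.r₀ (Sum.inr x) = Sum.inl (x : ZMod S.n) := rfl

theorem z_inl (x : ZMod S.n) : S.z (Sum.inl x) = Sum.inl (-x) := rfl

theorem z_inr (x : S.D) : S.z (Sum.inr x) = Sum.inr ⟨-x, S.neg_mem_D x x.2⟩ := rfl

theorem r₁_inl (x : ZMod S.n) : S.r₁ (Sum.inl x) = Sum.inl (1 - x) := rfl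

theorem r₁_inr_of_mem {x : S.D} (h : (x : ZMod S.n) ∈ S.E) :
    S.r₁ (Sum.inr x) = Sum.inr x := by
  simp [r₁, Function.Involutive.toPerm, h]

theorem r₁_inr_of_notMem {x : S.D} (h : (x : ZMod S.n) ∉ S.E) :
    S.r₁ (Sum.inr x) = Sum.inr ⟨-x, S.neg_mem_D x x.2⟩ := by
  simp [r₁, Function.Involutive.toPerm, h]

theorem r₀_r₀ (p) : S.r₀ (S.r₀ p) = p := Equiv.symm_apply_apply S.r₀ p

theorem z_z (p) : S.z (S.z p) = p := Equiv.symm_apply_apply S.z p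

theorem r₁_r₁ (p) : S.r₁ (S.r₁ p) = p := Equiv.symm_apply_apply S.r₁ p

theorem neg_notMem_D {x : ZMod S.n} (h : x ∉ S.D) : -x ∉ S.D :=
  fun hx => h (by simpa using S.neg_mem_D _ hx)

theorem r₀_z (p) : S.r₀ (S.z p) = S.z (S.r₀ p) := by
  rcases p with x | x
  · by_cases h : x ∈ S.D
    · rw [z_inl, r₀_inl_of_mem S h, r₀_inl_of_mem S (S.neg_mem_D x h), z_inr]
    · rw [z_inl, r₀_inl_of_notMem S h, r₀_inl_of_notMem S (S.neg_notMem_D h), z_inl, S.ρ_neg]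
  · rw [z_inr, r₀_inr, r₀_inr, z_inl]

/-- The rotation `r₁r₀r₂` of the strip. -/
theorem r₁_z_inl (x : ZMod S.n) : S.r₁ (S.z (Sum.inl x)) = Sum.inl (x + 1) := by
  rw [z_inl, r₁_inl, sub_neg_eq_add, add_comm]

/-- On each pair of additional flags at `±x`, `r₁` is either the identity or `z`, so `r₁z` is `z` or
the identity. -/
theorem r₁_z_r₁_z_inr (x : S.D) : S.r₁ (S.z (S.r₁ (S.z (Sum.inr x)))) = Sum.inr x := by
  by_cases h : (x : ZMod S.n) ∈ S.E
  · have h' := S.neg_mem_E _ h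
    rw [z_inr, r₁_inr_of_mem S h', z_inr, r₁_inr_of_mem S (by simpa using h)]
    simp
  · have h' : -(x : ZMod S.n) ∉ S.E := fun hx => h (by simpa using S.neg_mem_E _ hx)
    rw [z_inr, r₁_inr_of_notMem S h', z_inr, r₁_inr_of_notMem S (by simpa using h')]
    simp

theorem pow_inl (k : ℕ) (x : ZMod S.n) :
    ((S.r₁ * S.z) ^ k) (Sum.inl x) = Sum.inl (x + k) := by
  induction k with
  | zero => simp
  | succ k ih =>
    rw [pow_succ', Equiv.Perm.mul_apply, ih, Equiv.Perm.mul_apply, r₁_z_inl]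
    push_cast
    rw [add_assoc]

theorem exists_pow_inl (x y : ZMod S.n) : ∃ k : ℕ, ((S.r₁ * S.z) ^ k) (Sum.inl x) = Sum.inl y := by
  have : NeZero S.n := ⟨by have := S.four_lt; omega⟩
  refine ⟨(y - x).val, ?_⟩
  rw [pow_inl, ZMod.natCast_zmod_val, add_sub_cancel]

/-- The map belonging to the data. -/
noncomputable def toFlagMap : FlagMap where
  Flag := ZMod S.n ⊕ S.D
  r := ![S.r₀, S.r₁, S.r₀ * S.z]
  r_sq i := by
    ext1 p
    fin_cases i
    · exact S.r₀_r₀ p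
    · exact S.r₁_r₁ p
    · change S.r₀ (S.z (S.r₀ (S.z p))) = p
      rw [← r₀_z, r₀_r₀, z_z]
  r_zero_two_sq := by
    ext1 p
    change S.r₀ (S.r₀ (S.z (S.r₀ (S.r₀ (S.z p))))) = p
    rw [r₀_r₀, r₀_r₀, z_z]
  flag_nonempty := ⟨Sum.inl 0⟩
  connected := by
    set r := ![S.r₀, S.r₁, S.r₀ * S.z] with hr
    have h0 : S.r₀ ∈ Subgroup.closure (Set.range r) := Subgroup.subset_closure ⟨0, rfl⟩
    have h1 : S.r₁ ∈ Subgroup.closure (Set.range r) := Subgroup.subset_closure ⟨1, rfl⟩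
    have h2 : S.r₀ * S.z ∈ Subgroup.closure (Set.range r) := Subgroup.subset_closure ⟨2, rfl⟩
    have hz : S.z ∈ Subgroup.closure (Set.range r) := (Subgroup.mul_mem_cancel_left _ h0).1 h2
    have key : ∀ p, ∃ g ∈ Subgroup.closure (Set.range r), g (Sum.inl 0) = p := by
      rintro (x | x)
      · obtain ⟨k, hk⟩ := S.exists_pow_inl 0 x
        exact ⟨_, pow_mem (mul_mem h1 hz) k, hk⟩
      · obtain ⟨k, hk⟩ := S.exists_pow_inl 0 x
        refine ⟨_, mul_mem h0 (pow_mem (mul_mem h1 hz) k), ?_⟩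
        rw [Equiv.Perm.mul_apply, hk, r₀_inl_of_mem S x.2]
    intro p q
    obtain ⟨g, hg, rfl⟩ := key p
    obtain ⟨k, hk, rfl⟩ := key q
    exact ⟨k * g⁻¹, mul_mem hk (inv_mem hg), by simp⟩

instance : Finite S.toFlagMap.Flag := by
  have : NeZero S.n := ⟨by have := S.four_lt; omega⟩
  exact inferInstanceAs (Finite (ZMod S.n ⊕ S.D))

/-- The action of `Γ` on the flags. -/
noncomputable def act : MapGroup →* Equiv.Perm (ZMod S.n ⊕ S.D) := S.toFlagMap.rep

theorem act_R_zero : S.act (R 0) = S.r₀ := S.toFlagMap.rep_R 0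

theorem act_rotation : S.act (R 1 * (R 0 * R 2)) = S.r₁ * S.z := by
  have h1 : S.act (R 1) = S.r₁ := S.toFlagMap.rep_R 1
  have h2 : S.act (R 2) = S.r₀ * S.z := S.toFlagMap.rep_R 2
  rw [map_mul, map_mul, act_R_zero, h1, h2]
  ext1 p
  simp only [Equiv.Perm.mul_apply, r₀_r₀]

theorem isRigid : S.toFlagMap.IsRigid (Sum.inl 0 : ZMod S.n ⊕ S.D) := by
  change ∀ ψ : ZMod S.n ⊕ S.D,
    (∀ t w, S.act w (S.act t (Sum.inl 0)) = S.act t (Sum.inl 0) →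
      S.act (w ^ 2) (S.act t ψ) = S.act t ψ) →
    (∀ t w, S.act w (S.act t ψ) = S.act t ψ →
      S.act (w ^ 2) (S.act t (Sum.inl 0)) = S.act t (Sum.inl 0)) → ψ = Sum.inl 0
  intro ψ h1 h2
  have four_ne : (4 : ZMod S.n) ≠ 0 := by
    intro h
    have : ((4 : ℕ) : ZMod S.n) = 0 := by exact_mod_cast h
    exact absurd (Nat.le_of_dvd (by norm_num) ((ZMod.natCast_eq_zero_iff 4 S.n).1 this))
      (by have := S.four_lt; omega)
  have inr_fixed : ∀ x : S.D, ((S.r₁ * S.z) ^ 2) (Sum.inr x) = Sum.inr x := by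
    intro x
    rw [sq]
    exact S.r₁_z_r₁_z_inr x
  have inl_moved : ∀ x : ZMod S.n, ((S.r₁ * S.z) ^ 4) (Sum.inl x) ≠ Sum.inl x := by
    intro x hx
    rw [pow_inl, Sum.inl.injEq, add_eq_left] at hx
    exact four_ne (by exact_mod_cast hx)
  -- `u` fixes every additional flag, but `u ^ 2` moves every strip flag because `4 ≠ 0` in `ZMod
  -- n`. So each `t` carries both flags into the strip or neither.
  let u : MapGroup := (R 1 * (R 0 * R 2)) ^ 2
  have hu : S.act u = (S.r₁ * S.z) ^ 2 := by rw [map_pow, act_rotation]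
  have hu2 : S.act (u ^ 2) = (S.r₁ * S.z) ^ 4 := by rw [map_pow, hu, ← pow_mul]
  have same : ∀ t, (∃ x, S.act t (Sum.inl 0) = Sum.inl x) ↔
      ∃ y, S.act t ψ = Sum.inl y := by
    intro t
    constructor
    · rintro ⟨x, hx⟩
      rcases hy : S.act t ψ with y | y
      · exact ⟨y, rfl⟩
      · have := h2 t u (by rw [hu, hy]; exact inr_fixed y)
        rw [hu2, hx] at this
        exact absurd this (inl_moved x)
    · rintro ⟨y, hy⟩
      rcases hx : S.act t (Sum.inl 0) with x | x
      · exact ⟨x, rfl⟩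
      · have := h1 t u (by rw [hu, hx]; exact inr_fixed x)
        rw [hu2, hy] at this
        exact absurd this (inl_moved y)
  obtain ⟨j, rfl⟩ : ∃ j, ψ = Sum.inl j := by
    simpa using (same 1).1 ⟨0, by simp⟩
  have mem_iff : ∀ x : ZMod S.n, (∃ y, S.r₀ (Sum.inl x) = Sum.inl y) ↔ x ∉ S.D := by
    intro x
    by_cases h : x ∈ S.D
    · simp [r₀_inl_of_mem S h, h]
    · simp [r₀_inl_of_notMem S h, h]
  have hj : j = 0 := by
    -- Rotate `0` and `j` to `x` and `x + j`, then apply `r₀`: it leaves the strip exactly at the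
    -- flags of `D`.
    refine S.aperiodic j fun x => ?_
    obtain ⟨k, hk⟩ := S.exists_pow_inl 0 x
    have hkj : ((S.r₁ * S.z) ^ k) (Sum.inl j) = Sum.inl (x + j) := by
      rw [pow_inl, zero_add, Sum.inl.injEq] at hk
      rw [pow_inl, hk, add_comm]
    have ht : S.act (R 0 * (R 1 * (R 0 * R 2)) ^ k) = S.r₀ * (S.r₁ * S.z) ^ k := by
      rw [map_mul, map_pow, act_rotation, act_R_zero]
    have := same (R 0 * (R 1 * (R 0 * R 2)) ^ k)
    rw [ht] at this
    simp only [Equiv.Perm.mul_apply] at this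
    rw [hk, hkj, mem_iff, mem_iff] at this
    exact not_iff_not.1 this
  rw [hj]

theorem encard_image_congr {α β γ : Type*} {f : α → β} {g : α → γ} {s : Set α}
    (h : ∀ x ∈ s, ∀ y ∈ s, f x = f y ↔ g x = g y) : (f '' s).encard = (g '' s).encard := by
  have : ∀ b : f '' s, ∃ x ∈ s, f x = b := fun b => b.2
  choose k hk hfk using this
  have inj : Function.Injective fun b : f '' s => g (k b) := by
    intro b c hbc
    rw [Subtype.ext_iff, ← hfk b, ← hfk c]
    exact (h _ (hk b) _ (hk c)).2 hbc
  have range : Set.range (fun b : f '' s => g (k b)) = g '' s := by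
    ext c
    constructor
    · rintro ⟨b, rfl⟩
      exact ⟨k b, hk b, rfl⟩
    · rintro ⟨x, hx, rfl⟩
      exact ⟨⟨f x, x, hx, rfl⟩, (h _ (hk _) _ hx).1 (hfk _)⟩
  rw [← range, ← Set.image_univ, inj.encard_image, Set.encard_univ]
  rfl

theorem encard_boundarySides_one :
    (S.toFlagMap.boundarySides 1).encard = {x : ZMod S.n | 1 - x = x}.encard + S.E.encard := by
  have inj : Function.Injective (S.toFlagMap.side 1) := by
    intro p q h
    simpa [FlagMap.side] using h
  have fixed : {p : ZMod S.n ⊕ S.D | S.r₁ p = p} =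
      Sum.inl '' {x : ZMod S.n | 1 - x = x} ∪ Sum.inr '' {x : S.D | (x : ZMod S.n) ∈ S.E} := by
    ext (x | x)
    · simp [r₁_inl]
    · by_cases h : (x : ZMod S.n) ∈ S.E
      · simp [r₁_inr_of_mem S h, h]
      · have := S.neg_ne x x.2
        simp [r₁_inr_of_notMem S h, h, Subtype.ext_iff, this]
  have disj : Disjoint (Sum.inl '' {x : ZMod S.n | 1 - x = x} : Set (ZMod S.n ⊕ S.D))
      (Sum.inr '' {x : S.D | (x : ZMod S.n) ∈ S.E}) := by
    rw [Set.disjoint_left]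
    rintro _ ⟨x, -, rfl⟩ ⟨y, -, h⟩
    cases h
  have hE : {x : S.D | (x : ZMod S.n) ∈ S.E}.encard = S.E.encard := by
    rw [← Subtype.val_injective.encard_image]
    congr 1
    ext x
    simpa using fun hx => S.E_subset hx
  rw [FlagMap.boundarySides, inj.encard_image]
  change {p : ZMod S.n ⊕ S.D | S.r₁ p = p}.encard = _
  rw [fixed, Set.encard_union_eq disj, Sum.inl_injective.encard_image,
    Sum.inr_injective.encard_image, hE]

/-- The distance of `x` from `0`. -/
abbrev dist {n : ℕ} (x : ZMod n) : ℕ := x.valMinAbs.natAbs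

/-- At a strip flag `x` fixed by `r₀`, the side of type 0 is `{x, -x}`, so sides are counted by
distances from `0`. -/
theorem encard_boundarySides_zero :
    (S.toFlagMap.boundarySides 0).encard = (dist '' {x | x ∉ S.D ∧ S.ρ x = x}).encard := by
  have fixed : {p : ZMod S.n ⊕ S.D | S.r₀ p = p} = Sum.inl '' {x | x ∉ S.D ∧ S.ρ x = x} := by
    ext (x | x)
    · by_cases h : x ∈ S.D
      · simp [r₀_inl_of_mem S h, h]
      · simp [r₀_inl_of_notMem S h, h]
    · simp [r₀_inr]
  rw [FlagMap.boundarySides]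
  change ((fun p : ZMod S.n ⊕ S.D => ((0 : Fin 3), s(p, S.r₀ (S.z p)))) ''
    {p : ZMod S.n ⊕ S.D | S.r₀ p = p}).encard = _
  rw [fixed, Set.image_image]
  have side : ∀ x, x ∉ S.D ∧ S.ρ x = x → S.r₀ (S.z (Sum.inl x)) = Sum.inl (-x) := by
    rintro x ⟨hx, hρ⟩
    rw [z_inl, r₀_inl_of_notMem S (S.neg_notMem_D hx), S.ρ_neg, hρ]
  refine encard_image_congr fun x hx y hy => ?_
  rw [side x hx, side y hy, ZMod.natAbs_valMinAbs_eq_natAbs_valMinAbs]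
  simp only [Prod.mk.injEq, true_and, Sym2.eq_iff, Sum.inl.injEq, neg_inj, and_self]
  refine or_congr_right ⟨fun h => h.1, fun h => ⟨h, by rw [h, neg_neg]⟩⟩

theorem encard_boundarySides_two :
    (S.toFlagMap.boundarySides 2).encard = (dist '' {x | x ∉ S.D ∧ S.ρ x = -x}).encard := by
  have fixed : {p : ZMod S.n ⊕ S.D | S.r₀ (S.z p) = p} =
      Sum.inl '' {x | x ∉ S.D ∧ S.ρ x = -x} := by
    ext (x | x)
    · by_cases h : x ∈ S.D
      · simp [z_inl, r₀_inl_of_mem S (S.neg_mem_D x h), h]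
      · simp [z_inl, r₀_inl_of_notMem S (S.neg_notMem_D h), h, S.ρ_neg, neg_eq_iff_eq_neg]
    · simp [z_inr, r₀_inr]
  rw [FlagMap.boundarySides]
  change ((fun p : ZMod S.n ⊕ S.D => ((2 : Fin 3), s(p, S.r₀ p))) ''
    {p : ZMod S.n ⊕ S.D | S.r₀ (S.z p) = p}).encard = _
  rw [fixed, Set.image_image]
  have side : ∀ x, x ∉ S.D ∧ S.ρ x = -x → S.r₀ (Sum.inl x) = Sum.inl (-x) := by
    rintro x ⟨hx, hρ⟩
    rw [r₀_inl_of_notMem S hx, hρ]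
  refine encard_image_congr fun x hx y hy => ?_
  rw [side x hx, side y hy, ZMod.natAbs_valMinAbs_eq_natAbs_valMinAbs]
  simp only [Prod.mk.injEq, true_and, Sym2.eq_iff, Sum.inl.injEq, neg_inj, and_self]
  refine or_congr_right ⟨fun h => h.1, fun h => ⟨h, by rw [h, neg_neg]⟩⟩

end StripData

/-! ### Strips with prescribed boundary. -/

/-- The involution `ρ` of a strip on the least absolute residues: it is `1` at the distances at most
`p` from `0`, and `-1` at the distances in `(p, q]`; the distances `q + 1` and `q + 2` are
interchanged, and `0` is interchanged with `q + 3` unless `e = 0`. -/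
def stripInvolution (e p q : ℕ) (k : ℤ) : ℤ :=
  if k = 0 then (if e = 0 then 0 else q + 3)
  -- The value `q + 3` is half the length of the strip when `e = 1`, and is outside the range of
  -- residues when `e = 0`.
  else if k = q + 3 then 0
  else if k.natAbs ≤ p then k
  else if k.natAbs ≤ q then -k
  else if 0 < k then 2 * q + 3 - k
  else -(2 * q + 3) - k

namespace ZMod

theorem encard_setOf_dist_mem {n : ℕ} [NeZero n] {m : ℕ} (hm : 2 * m < n) :
    {x : ZMod n | 1 ≤ x.valMinAbs.natAbs ∧ x.valMinAbs.natAbs ≤ m}.encard = (2 * m : ℕ) := by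
  rw [← ZMod.injective_valMinAbs.encard_image]
  have : ZMod.valMinAbs '' {x : ZMod n | 1 ≤ x.valMinAbs.natAbs ∧ x.valMinAbs.natAbs ≤ m} =
      ((Finset.Icc (-m : ℤ) m).erase 0 : Finset ℤ) := by
    ext k
    simp only [Set.mem_image, Set.mem_ofPred_eq, Finset.coe_erase, Finset.coe_Icc, Set.mem_sdiff,
      Set.mem_Icc, Set.mem_singleton_iff]
    constructor
    · rintro ⟨x, hx, rfl⟩
      omega
    · intro hk
      have : (k : ZMod n).valMinAbs = k :=
        (ZMod.valMinAbs_spec _ _).2 ⟨rfl, by rw [Set.mem_Ioc]; omega⟩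
      exact ⟨k, by rw [this]; omega, this⟩
  rw [this, Set.encard_coe_eq_coe_finsetCard, Finset.card_erase_of_mem (by simp), Int.card_Icc]
  congr 1
  omega

end ZMod

section Strip

/-- The length of the strip. -/
abbrev stripLength (e m a b : ℕ) : ℕ := 2 * (m + 1 + a + b) + 5 + e

/-- The values of `valMinAbs` on the strip. -/
def StripRange (e m a b : ℕ) (k : ℤ) : Prop :=
  -((m + 1 + a + b : ℕ) + 2 : ℤ) ≤ k ∧ k ≤ (m + 1 + a + b : ℕ) + 2 + e

variable {e m a b : ℕ}

theorem stripRange_iff (he : e ≤ 1) {k : ℤ} : StripRange e m a b k ↔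
    k * 2 ∈ Set.Ioc (-(stripLength e m a b : ℤ)) (stripLength e m a b) := by
  unfold StripRange stripLength
  rw [Set.mem_Ioc]
  omega

theorem stripRange_valMinAbs (he : e ≤ 1) (x : ZMod (stripLength e m a b)) : StripRange e m a b x.valMinAbs :=
  (stripRange_iff he).2 x.valMinAbs_mem_Ioc

theorem valMinAbs_intCast_strip (he : e ≤ 1) {k : ℤ} (h : StripRange e m a b k) :
    (k : ZMod (stripLength e m a b)).valMinAbs = k :=
  (ZMod.valMinAbs_spec _ _).2 ⟨rfl, (stripRange_iff he).1 h⟩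

theorem stripInvolution_range (he : e ≤ 1) {k : ℤ} (h : StripRange e m a b k) :
    StripRange e m a b (stripInvolution e (m + 1 + a) (m + 1 + a + b) k) := by
  unfold StripRange stripInvolution at *
  split_ifs <;> omega

theorem stripInvolution_invol (he : e ≤ 1) {k : ℤ} (h : StripRange e m a b k) :
    stripInvolution e (m + 1 + a) (m + 1 + a + b)
      (stripInvolution e (m + 1 + a) (m + 1 + a + b) k) = k := by
  generalize hj : stripInvolution e (m + 1 + a) (m + 1 + a + b) k = j
  unfold StripRange at h
  unfold stripInvolution at hj ⊢
  split_ifs at hj <;> split_ifs <;> omega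

/-- The excluded residue is half of an even length, which is its own negative. -/
theorem valMinAbs_neg_strip (he : e ≤ 1) (x : ZMod (stripLength e m a b))
    (h : x.valMinAbs ≠ (m + 1 + a + b : ℕ) + 3) : (-x).valMinAbs = -x.valMinAbs := by
  have hx := stripRange_valMinAbs he x
  have hr : StripRange e m a b (-x.valMinAbs) := by
    unfold StripRange at *
    omega
  conv_lhs => rw [← ZMod.coe_valMinAbs x, ← Int.cast_neg]
  exact valMinAbs_intCast_strip he hr

theorem neg_eq_self_strip (he : e ≤ 1) {x : ZMod (stripLength e m a b)}
    (h : x.valMinAbs = (m + 1 + a + b : ℕ) + 3) : -x = x := by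
  have h1 : e = 1 := by
    have := stripRange_valMinAbs he x
    unfold StripRange at this
    omega
  rw [neg_eq_iff_add_eq_zero, ← ZMod.coe_valMinAbs x, h]
  have : ((stripLength e m a b : ℕ) : ZMod (stripLength e m a b)) = 0 := ZMod.natCast_self _
  rw [← this, stripLength, h1]
  push_cast
  ring

variable (e m a b : ℕ)

/-- The strip with `m` pairs of boundary sides of type `1` at the additional flags, and with
`a` and `b` boundary sides of types `0` and `2` away from the ends of the strip. -/
def strip (he : e ≤ 1) : StripData where
  n := stripLength e m a b
  four_lt := by unfold stripLength; omega
  -- The bound is `m + 1` rather than `m` so that `D` contains `±1` even for `m = 0`; the flags at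
  -- distance `m + 1` lie outside `E` and add no boundary.
  D := {x | 1 ≤ x.valMinAbs.natAbs ∧ x.valMinAbs.natAbs ≤ m + 1}
  E := {x | 1 ≤ x.valMinAbs.natAbs ∧ x.valMinAbs.natAbs ≤ m}
  ρ x := (stripInvolution e (m + 1 + a) (m + 1 + a + b) x.valMinAbs : ℤ)
  neg_mem_D x hx := by simpa [ZMod.natAbs_valMinAbs_neg] using hx
  neg_mem_E x hx := by simpa [ZMod.natAbs_valMinAbs_neg] using hx
  E_subset x hx := ⟨hx.1, hx.2.trans (Nat.le_succ m)⟩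
  neg_ne x hx h := by
    have h1 := valMinAbs_neg_strip he x (by have := hx.2; omega)
    have h2 := hx.1
    rw [h] at h1
    omega
  ρ_ρ x := by
    rw [valMinAbs_intCast_strip he (stripInvolution_range he (stripRange_valMinAbs he x)),
      stripInvolution_invol he (stripRange_valMinAbs he x), ZMod.coe_valMinAbs]
  ρ_neg x := by
    by_cases h : x.valMinAbs = (m + 1 + a + b : ℕ) + 3
    · rw [neg_eq_self_strip he h, h]
      have h3 : ((m + 1 + a + b : ℕ) : ℤ) + 3 ≠ 0 := by omega
      simp only [stripInvolution, if_neg h3, if_true, Int.cast_zero, neg_zero]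
    · rw [valMinAbs_neg_strip he x h]
      by_cases h0 : x.valMinAbs = 0
      · rw [h0, neg_zero]
        have hq : stripInvolution e (m + 1 + a) (m + 1 + a + b) 0 = 0 ∨
            (stripInvolution e (m + 1 + a) (m + 1 + a + b) 0 = (m + 1 + a + b : ℕ) + 3 ∧
              e = 1) := by
          unfold stripInvolution
          split_ifs <;> omega
        rcases hq with hq | ⟨hq, rfl⟩
        · rw [hq, Int.cast_zero, neg_zero]
        · rw [hq, eq_comm]
          refine neg_eq_self_strip he (valMinAbs_intCast_strip he ?_)
          unfold StripRange
          omega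
      · rw [← Int.cast_neg]
        congr 1
        have := stripRange_valMinAbs he x
        unfold StripRange at this
        unfold stripInvolution
        split_ifs <;> omega
  ρ_mem_D x hx := by
    have hr := stripRange_valMinAbs he x
    rw [Set.mem_ofPred_eq, valMinAbs_intCast_strip he (stripInvolution_range he hr)] at hx
    rw [Set.mem_ofPred_eq]
    unfold StripRange at hr
    unfold stripInvolution at hx
    split_ifs at hx <;> omega
  aperiodic j hj := by
    have cast_mem : ∀ k : ℤ, StripRange e m a b k →
        ((k : ZMod (stripLength e m a b)) ∈ {x : ZMod (stripLength e m a b) |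
          1 ≤ x.valMinAbs.natAbs ∧ x.valMinAbs.natAbs ≤ m + 1} ↔
            1 ≤ k.natAbs ∧ k.natAbs ≤ m + 1) := by
      intro k hk
      rw [Set.mem_ofPred_eq, valMinAbs_intCast_strip he hk]
    obtain ⟨k, hk, rfl⟩ : ∃ k : ℤ, StripRange e m a b k ∧ (k : ZMod (stripLength e m a b)) = j :=
      ⟨_, stripRange_valMinAbs he j, ZMod.coe_valMinAbs j⟩
    -- Only `0` is outside `D` with both neighbours in `D`: the rest of the complement is a single
    -- run of more than one flag, since the distances `q + 1` and `q + 2`, with `q = m + 1 + a + b`,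
    -- are outside `D`.
    have h0 := hj ((0 : ℤ) : ZMod (stripLength e m a b))
    have h1 := hj ((1 : ℤ) : ZMod (stripLength e m a b))
    have h2 := hj ((-1 : ℤ) : ZMod (stripLength e m a b))
    rw [← Int.cast_add] at h0 h1 h2
    rw [cast_mem _ (by unfold StripRange; omega)] at h0 h1 h2
    rw [zero_add, cast_mem _ hk] at h0
    unfold StripRange at hk cast_mem
    by_cases hk0 : k = 0
    · rw [hk0, Int.cast_zero]
    exfalso
    rcases lt_or_gt_of_ne hk0 with hneg | hpos
    · rw [cast_mem (1 + k) (by omega)] at h1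
      by_cases hb : -((m + 1 + a + b : ℕ) + 2 : ℤ) ≤ -1 + k
      · rw [cast_mem (-1 + k) (by omega)] at h2
        omega
      · omega
    · rw [cast_mem (-1 + k) (by omega)] at h2
      by_cases hb : 1 + k ≤ (m + 1 + a + b : ℕ) + 2 + e
      · rw [cast_mem (1 + k) (by omega)] at h1
        omega
      · omega

variable {e m a b}

theorem mem_image_dist_iff (he : e ≤ 1) {P : ℤ → Prop} {k : ℕ} :
    k ∈ StripData.dist '' {x : ZMod (stripLength e m a b) | P x.valMinAbs} ↔
      (StripRange e m a b k ∧ P k) ∨ (StripRange e m a b (-k) ∧ P (-k)) := by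
  constructor
  · rintro ⟨x, hx, rfl⟩
    have hr := stripRange_valMinAbs he x
    rcases Int.natAbs_eq x.valMinAbs with h | h
    · rw [Set.mem_ofPred_eq, h] at hx
      rw [h] at hr
      exact Or.inl ⟨hr, hx⟩
    · rw [Set.mem_ofPred_eq, h] at hx
      rw [h] at hr
      exact Or.inr ⟨hr, hx⟩
  · rintro (⟨hr, hP⟩ | ⟨hr, hP⟩)
    · refine ⟨_, (by rwa [Set.mem_ofPred_eq, valMinAbs_intCast_strip he hr] :
        ((k : ℤ) : ZMod (stripLength e m a b)) ∈ _), ?_⟩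
      rw [StripData.dist, valMinAbs_intCast_strip he hr]
      omega
    · refine ⟨_, (by rwa [Set.mem_ofPred_eq, valMinAbs_intCast_strip he hr] :
        ((-k : ℤ) : ZMod (stripLength e m a b)) ∈ _), ?_⟩
      rw [StripData.dist, valMinAbs_intCast_strip he hr]
      omega


theorem card_distances (he : e ≤ 1) (k l : ℕ) :
    {x : ℕ | (x = 0 ∧ e = 0) ∨ (k + 1 ≤ x ∧ x ≤ k + l)}.encard = (l + (1 - e) : ℕ) := by
  have : {x : ℕ | (x = 0 ∧ e = 0) ∨ (k + 1 ≤ x ∧ x ≤ k + l)} =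
      ((if e = 0 then insert 0 (Finset.Icc (k + 1) (k + l)) else Finset.Icc (k + 1) (k + l) :
        Finset ℕ) : Set ℕ) := by
    ext x
    split_ifs with h <;> simp [h]
  rw [this, Set.encard_coe_eq_coe_finsetCard]
  congr 1
  split_ifs with h
  · rw [Finset.card_insert_of_notMem (by simp), Nat.card_Icc]
    omega
  · rw [Nat.card_Icc]
    omega

theorem intCast_eq_iff_strip (he : e ≤ 1) {k l : ℤ} (hk : StripRange e m a b k)
    (hl : StripRange e m a b l) :
    (k : ZMod (stripLength e m a b)) = (l : ZMod (stripLength e m a b)) ↔ k = l := by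
  rw [← ZMod.valMinAbs_inj, valMinAbs_intCast_strip he hk, valMinAbs_intCast_strip he hl]

theorem stripInvolution_cast_eq_iff (he : e ≤ 1) (x : ZMod (stripLength e m a b)) :
    (stripInvolution e (m + 1 + a) (m + 1 + a + b) x.valMinAbs : ZMod (stripLength e m a b)) = x ↔
      stripInvolution e (m + 1 + a) (m + 1 + a + b) x.valMinAbs = x.valMinAbs := by
  have hr := stripRange_valMinAbs he x
  have := intCast_eq_iff_strip he (stripInvolution_range he hr) hr
  rwa [ZMod.coe_valMinAbs] at this

theorem stripInvolution_cast_eq_neg_iff (he : e ≤ 1) (x : ZMod (stripLength e m a b)) :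
    (stripInvolution e (m + 1 + a) (m + 1 + a + b) x.valMinAbs : ZMod (stripLength e m a b)) =
      -x ↔ stripInvolution e (m + 1 + a) (m + 1 + a + b) x.valMinAbs = -x.valMinAbs := by
  have hr := stripRange_valMinAbs he x
  by_cases h : x.valMinAbs = (m + 1 + a + b : ℕ) + 3
  · have h3 : ((m + 1 + a + b : ℕ) : ℤ) + 3 ≠ 0 := by omega
    have hx : stripInvolution e (m + 1 + a) (m + 1 + a + b) x.valMinAbs = 0 := by
      rw [h]
      simp only [stripInvolution, if_neg h3, if_true]
    rw [hx]
    refine iff_of_false (fun h0 => ?_) (by omega)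
    rw [neg_eq_self_strip he h, Int.cast_zero] at h0
    rw [← h0, ZMod.valMinAbs_zero] at h
    exact h3 h.symm
  · have := intCast_eq_iff_strip he (stripInvolution_range he hr) (stripRange_valMinAbs he (-x))
    rwa [ZMod.coe_valMinAbs, valMinAbs_neg_strip he x h] at this

theorem encard_boundarySides_zero_strip (he : e ≤ 1) :
    ((strip e m a b he).toFlagMap.boundarySides 0).encard = (a + (1 - e) : ℕ) := by
  rw [StripData.encard_boundarySides_zero, ← card_distances he (m + 1) a]
  let P : ℤ → Prop := fun k => ¬(1 ≤ k.natAbs ∧ k.natAbs ≤ m + 1) ∧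
    stripInvolution e (m + 1 + a) (m + 1 + a + b) k = k
  have hP : {x | x ∉ (strip e m a b he).D ∧ (strip e m a b he).ρ x = x} =
      {x : ZMod (stripLength e m a b) | P x.valMinAbs} :=
    Set.ext fun x : ZMod (stripLength e m a b) =>
      and_congr Iff.rfl (stripInvolution_cast_eq_iff he x)
  congr 1
  ext k
  rw [hP, Set.mem_ofPred_eq]
  refine (mem_image_dist_iff he).trans ?_
  simp only [P, StripRange, stripInvolution]
  split_ifs <;> omega

theorem encard_boundarySides_two_strip (he : e ≤ 1) :
    ((strip e m a b he).toFlagMap.boundarySides 2).encard = (b + (1 - e) : ℕ) := by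
  rw [StripData.encard_boundarySides_two, ← card_distances he (m + 1 + a) b]
  let P : ℤ → Prop := fun k => ¬(1 ≤ k.natAbs ∧ k.natAbs ≤ m + 1) ∧
    stripInvolution e (m + 1 + a) (m + 1 + a + b) k = -k
  have hP : {x | x ∉ (strip e m a b he).D ∧ (strip e m a b he).ρ x = -x} =
      {x : ZMod (stripLength e m a b) | P x.valMinAbs} :=
    Set.ext fun x : ZMod (stripLength e m a b) =>
      and_congr Iff.rfl (stripInvolution_cast_eq_neg_iff he x)
  congr 1
  ext k
  rw [hP, Set.mem_ofPred_eq]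
  refine (mem_image_dist_iff he).trans ?_
  simp only [P, StripRange, stripInvolution]
  split_ifs <;> omega

theorem encard_fixed_reflection_strip (he : e ≤ 1) :
    {x : ZMod (stripLength e m a b) | 1 - x = x}.encard = (1 - e : ℕ) := by
  have key : ∀ x : ZMod (stripLength e m a b), 1 - x = x ↔
      x.valMinAbs = -((m + 1 + a + b : ℕ) + 2) ∧ e = 0 := by
    intro x
    have hr := stripRange_valMinAbs he x
    unfold StripRange at hr
    have h1 : 1 - x = x ↔ ((2 * x.valMinAbs - 1 : ℤ) : ZMod (stripLength e m a b)) = 0 := by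
      have hx : ((x.valMinAbs : ℤ) : ZMod (stripLength e m a b)) = x := ZMod.coe_valMinAbs x
      rw [Int.cast_sub, Int.cast_mul, hx, sub_eq_zero, sub_eq_iff_eq_add, eq_comm]
      simp [two_mul]
    rw [h1, ZMod.intCast_zmod_eq_zero_iff_dvd]
    constructor
    · rintro ⟨c, hc⟩
      unfold stripLength at hc
      push_cast at hc hr ⊢
      -- The size of the residue leaves only `c = 0`, impossible by parity, and `c = -1`, which
      -- forces odd length.
      have h2 : c < 1 := by by_contra! h; nlinarith
      have h3 : -2 < c := by by_contra! h; nlinarith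
      obtain rfl | rfl : c = 0 ∨ c = -1 := by omega
      · omega
      · omega
    · rintro ⟨h, rfl⟩
      refine ⟨-1, ?_⟩
      rw [h]
      unfold stripLength
      push_cast
      ring
  simp only [key]
  interval_cases e
  · have : {x : ZMod (stripLength 0 m a b) | x.valMinAbs = -((m + 1 + a + b : ℕ) + 2) ∧ 0 = 0} =
        {((-((m + 1 + a + b : ℕ) + 2) : ℤ) : ZMod (stripLength 0 m a b))} := by
      ext x
      have hr : StripRange 0 m a b (-((m + 1 + a + b : ℕ) + 2)) := by unfold StripRange; omega
      rw [Set.mem_ofPred_eq, Set.mem_singleton_iff, ← ZMod.valMinAbs_inj,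
        valMinAbs_intCast_strip he hr]
      simp
    rw [this, Set.encard_singleton]
    rfl
  · simp

theorem encard_boundarySides_one_strip (he : e ≤ 1) :
    ((strip e m a b he).toFlagMap.boundarySides 1).encard = ((1 - e) + 2 * m : ℕ) := by
  rw [StripData.encard_boundarySides_one, Nat.cast_add]
  exact congrArg₂ _ (encard_fixed_reflection_strip he)
    (ZMod.encard_setOf_dist_mem (n := stripLength e m a b) (by unfold stripLength; omega))

end Strip

theorem mainTheorem5 (c₀ c₁ c₂ : ℕ) (h : Odd c₁ → 1 ≤ c₀ ∧ 1 ≤ c₂) :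
    ∃ (𝓜 : FlagMap) (φ : 𝓜.Flag) (N : Subgroup MapGroup),
      Finite 𝓜.Flag ∧
      (𝓜.crType 0 = c₀ ∧ 𝓜.crType 1 = c₁ ∧ 𝓜.crType 2 = c₂ ∧
        𝓜.cr = c₀ + c₁ + c₂) ∧
      N.FiniteIndex ∧
      𝓜.mapSubgroup φ = commSquares N ∧
      Subgroup.normalizer (𝓜.mapSubgroup φ : Set MapGroup) = N := by
  rw [Nat.odd_iff] at h
  have he : 1 - c₁ % 2 ≤ 1 := by omega
  -- Odd `c₁` needs odd length (`e = 0`), which already supplies one side of each type. The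
  -- hypothesis makes the truncated subtractions from `c₀` and `c₂` exact.
  refine exists_map_of_isRigid
    (strip (1 - c₁ % 2) (c₁ / 2) (c₀ - c₁ % 2) (c₂ - c₁ % 2) he).isRigid ?_ ?_ ?_
  · rw [encard_boundarySides_zero_strip]
    congr 1
    omega
  · rw [encard_boundarySides_one_strip]
    congr 1
    omega
  · rw [encard_boundarySides_two_strip]
    congr 1
    omega
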